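/- Let $n,d\ge 1$ and let $\mu=(m_1,\dots,m_d)$ be positive integers with $m_1+\dots+m_d=n$. Let $\mathrm{Herm}(n)$ be the real vector space of $n\times n$ complex Hermitian matrices, and let $\mathcal D_\mu$ be the set of density matrices $\varrho\in\mathrm{Herm}(n)$ (that is, $\varrho$ positive definite with $\mathrm{Tr}\,\varrho=1$) whose eigenvalues $\lambda_1\ge\lambda_2\ge\dots\ge\lambda_n$, listed with multiplicity, satisfy $$\lambda_1=\dots=\lambda_{m_1}>\lambda_{m_1+1}=\dots=\lambda_{m_1+m_2}>\dots>\lambda_{m_1+\dots+m_{d-1}+1}=\dots=\lambda_{n}.$$ Then $\mathcal D_\mu$ is a real-analytic (embedded) submanifold of $\mathrm{Herm}(n)$ of codimension $\sum_{i=1}^d m_i^2-d+1$. -/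

import Mathlib

open scoped ComplexOrder

/-- The real vector space `Herm(n)` of complex Hermitian `n × n` matrices. -/
noncomputable abbrev Herm (n : ℕ) : Submodule ℝ (Matrix (Fin n) (Fin n) ℂ) :=
  selfAdjoint.submodule ℝ (Matrix (Fin n) (Fin n) ℂ)

/- The choice of norm on the finite-dimensional space of matrices is immaterial: it only serves to
speak of open sets and of analytic maps. -/
attribute [local instance] Matrix.normedAddCommGroup Matrix.normedSpace

/-- A slice chart for a subset `S` of a real normed space `E`: a real-analytic diffeomorphism `φ`
from an open set `φ.source ⊆ E` onto an open set `φ.target ⊆ ℝ^q × ℝ^k`, in whose coordinates `S` is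
given by the vanishing of the last `k` coordinates. -/
structure IsAnalyticSliceChart {E : Type*} [NormedAddCommGroup E] [NormedSpace ℝ E] (S : Set E)
    {q k : ℕ} (φ : OpenPartialHomeomorph E ((Fin q → ℝ) × (Fin k → ℝ))) : Prop where
  analyticOnNhd : AnalyticOnNhd ℝ φ φ.source
  analyticOnNhd_symm : AnalyticOnNhd ℝ φ.symm φ.target
  mem_iff : ∀ x ∈ φ.source, (x ∈ S ↔ (φ x).2 = 0)

/-- `S` is an (embedded) real-analytic submanifold of codimension `k` of the finite-dimensional real
normed space `E`: around each point of `S` there is a real-analytic slice chart to `ℝ^q × ℝ^k`, where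
`q + k = dim E`. -/
def IsAnalyticSubmanifold {E : Type*} [NormedAddCommGroup E] [NormedSpace ℝ E]
    (S : Set E) (k : ℕ) : Prop :=
  ∃ q : ℕ, q + k = Module.finrank ℝ E ∧
    ∀ p ∈ S, ∃ φ : OpenPartialHomeomorph E ((Fin q → ℝ) × (Fin k → ℝ)),
      p ∈ φ.source ∧ IsAnalyticSliceChart S φ

/-- The set of density matrices: positive definite Hermitian matrices of trace one. -/
def densityMatrices (n : ℕ) : Set (Herm n) :=
  {ρ | (ρ : Matrix (Fin n) (Fin n) ℂ).PosDef ∧ (ρ : Matrix (Fin n) (Fin n) ℂ).trace = 1}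

/-- The Hermitian matrices with multiplicity pattern `μ = (m_1, …, m_d)`: for some real numbers
`l_1 > ⋯ > l_d`, the eigenvalues, counted with multiplicity, are `l_i` repeated `m_i` times. -/
def hermStratum (n : ℕ) {d : ℕ} (m : Fin d → ℕ) : Set (Herm n) :=
  {A | ∃ l : Fin d → ℝ, StrictAnti l ∧
    (A : Matrix (Fin n) (Fin n) ℂ).charpoly.roots = ∑ i, Multiset.replicate (m i) (l i : ℂ)}

/-- The density matrices with multiplicity pattern `μ = (m_1, …, m_d)`. -/
def densityStratum (n : ℕ) {d : ℕ} (m : Fin d → ℕ) : Set (Herm n) :=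
  densityMatrices n ∩ hermStratum n m

/-!
Let `p` be a density matrix with multiplicity pattern `m`, and diagonalize it: `p = V D Vᴴ` with `V`
unitary and `D` diagonal with entries `l (β a)`, where `β` assigns to each index its block. A Hermitian
matrix `Z` splits into its block diagonal part `Y` and its part off the diagonal blocks, and the latter
is `2 (X D - D X)` for a skew-Hermitian `X` depending linearly on `Z` (`offBlockPart`). With `W` the
product of `V` and the Cayley transform `(1 + X) (1 - X)⁻¹`, which is unitary, the analytic map
`Z ↦ W (D + Y) Wᴴ` (`straightening`) sends `0` to `p`, and its derivative at `0` is `Z ↦ V Z Vᴴ`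
(`hasDerivAt_straightening`). By the analytic inverse function theorem it is an analytic local
diffeomorphism.

As `W` is unitary, `W (D + Y) Wᴴ` lies in the stratum if and only if `D + Y` does. For small `Y` this
means that every diagonal block of `Y` is a scalar and that the trace of `Y` vanishes
(`hasDensityPattern_diagonal_add_iff`): the `d` blocks of `D + Y` have eigenvalues close to the `d`
distinct numbers `l i`, so if there are only `d` distinct eigenvalues in all, each block has just one
(`eq_diagonal_of_eigenvalues`). These are linear conditions on `Z`, so the local inverse provides a
slice chart (`exists_isAnalyticSliceChart`). The linear space they define, `stratumModel β`, has one real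
parameter for each position off the diagonal blocks and one for each block, subject to one relation;
its dimension is therefore `n ^ 2 - ∑ i, m i ^ 2 + d - 1` (`finrank_stratumModel`).
-/

/-! ### Slice charts from parametrizations -/

open Topology in
/-- If an analytic map `Ψ` with invertible derivative at `0` straightens `S` near `Ψ 0` to a linear
subspace `V`, then its local inverse, followed by linear coordinates adapted to `V`, is a slice
chart for `S`. -/
theorem exists_isAnalyticSliceChart {E : Type*} [NormedAddCommGroup E] [NormedSpace ℝ E]
    [FiniteDimensional ℝ E] {S : Set E} {Ψ : E → E} (hΨ : AnalyticAt ℝ Ψ 0) (e : E ≃L[ℝ] E)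
    (he : HasFDerivAt Ψ (e : E →L[ℝ] E) 0) (V : Submodule ℝ E) {q k : ℕ}
    (hq : Module.finrank ℝ V = q) (hqk : q + k = Module.finrank ℝ E)
    (hS : ∀ᶠ z in 𝓝 0, (Ψ z ∈ S ↔ z ∈ V)) :
    ∃ φ : OpenPartialHomeomorph E ((Fin q → ℝ) × (Fin k → ℝ)),
      Ψ 0 ∈ φ.source ∧ IsAnalyticSliceChart S φ := by
  have : CompleteSpace E := FiniteDimensional.complete ℝ E
  have hstrict : HasStrictFDerivAt Ψ (e : E →L[ℝ] E) 0 := by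
    rw [← he.fderiv]; exact hΨ.hasStrictFDerivAt
  let T := hstrict.toOpenPartialHomeomorph Ψ
  have hT : ∀ z, T z = Ψ z := fun z => rfl
  have h0 : (0 : E) ∈ T.source := hstrict.mem_toOpenPartialHomeomorph_source
  obtain ⟨O, hO, hOo, h0O⟩ := eventually_nhds_iff.1 (hΨ.eventually_analyticAt.and hS)
  have hsymm : AnalyticAt ℝ T.symm (Ψ 0) := T.analyticAt_symm' h0 hΨ he.fderiv
  obtain ⟨O', hO', hOo', h0O'⟩ := eventually_nhds_iff.1 hsymm.eventually_analyticAt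
  obtain ⟨W, hW⟩ := V.exists_isCompl
  have hWk : Module.finrank ℝ W = k := by
    have := Submodule.finrank_add_eq_of_isCompl hW
    omega
  let L : E ≃L[ℝ] (Fin q → ℝ) × (Fin k → ℝ) := ((V.prodEquivOfIsCompl W hW).symm.trans
    ((LinearEquiv.ofFinrankEq V (Fin q → ℝ) (by simp [hq])).prodCongr
      (LinearEquiv.ofFinrankEq W (Fin k → ℝ) (by simp [hWk])))).toContinuousLinearEquiv
  have hL : ∀ z, (L z).2 = 0 ↔ z ∈ V := fun z => by
    simp [L]
  refine ⟨((T.restrOpen O hOo).symm.restrOpen O' hOo').trans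
    L.toHomeomorph.toOpenPartialHomeomorph, ?_, ?_, ?_, ?_⟩
  · simp only [OpenPartialHomeomorph.trans_source]
    have h1 : Ψ 0 ∈ T.target := T.map_source h0
    have h2 : T.symm (Ψ 0) = 0 := T.left_inv h0
    simp [h1, h2, h0O, h0O']
  · rintro x hx
    have hx' : x ∈ O' := by simp at hx; tauto
    exact (L.analyticAt _).comp (hO' x hx')
  · rintro y hy
    have hy' : L.symm y ∈ O := by
      simp at hy
      tauto
    exact (hO _ hy').1.comp (L.symm.analyticAt y)
  · rintro x hx
    have hx' : x ∈ T.target ∧ T.symm x ∈ O := by simp at hx; tauto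
    have h1 : T (T.symm x) = x := T.right_inv hx'.1
    have h2 := (hO _ hx'.2).2
    rw [← hT, h1] at h2
    exact h2.trans (hL _).symm

/-! ### The linear model of the stratum and its dimension -/

/-- The real-linear isomorphism `R ↦ (R + Rᵀ) / 2 + i (R - Rᵀ) / 2` from real matrices to Hermitian
matrices; its inverse is `Z ↦ Re Z + Im Z`. -/
noncomputable def hermEquivReal (n : ℕ) : Matrix (Fin n) (Fin n) ℝ ≃ₗ[ℝ] Herm n where
  toFun R := ⟨Matrix.of fun a b => ⟨(R a b + R b a) / 2, (R a b - R b a) / 2⟩, by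
    refine Matrix.ext fun a b => Complex.ext ?_ ?_ <;> simp <;> ring⟩
  invFun Z := Matrix.of fun a b => (Z.1 a b).re + (Z.1 a b).im
  map_add' R R' := Subtype.ext <| Matrix.ext fun a b => by
    apply Complex.ext <;> simp <;> ring
  map_smul' t R := Subtype.ext <| Matrix.ext fun a b => by
    apply Complex.ext <;> simp <;> ring
  left_inv R := by ext a b; simp; ring
  right_inv Z := Subtype.ext <| Matrix.ext fun a b => by
    have h : star (Z.1 b a) = Z.1 a b := congrFun (congrFun Z.2 a) b
    have h1 : (Z.1 b a).re = (Z.1 a b).re := by rw [← h]; simp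
    have h2 : (Z.1 b a).im = -(Z.1 a b).im := by rw [← h]; simp
    apply Complex.ext <;> simp [h1, h2]
    ring

theorem finrank_herm (n : ℕ) : Module.finrank ℝ (Herm n) = n ^ 2 := by
  rw [← (hermEquivReal n).finrank_eq]
  simp [Module.finrank_matrix, sq]

/-- The Hermitian matrices whose diagonal blocks, with respect to the partition of the indices into
the fibres of `β`, are real scalars, and whose trace vanishes. The blocks off the diagonal are
arbitrary. In suitable coordinates the stratum is this linear space. -/
def stratumModel {n d : ℕ} (β : Fin n → Fin d) : Submodule ℝ (Herm n) where
  carrier := {Z | ∃ c : Fin d → ℝ, ∑ a, c (β a) = 0 ∧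
    ∀ a b, β a = β b → Z.1 a b = if a = b then (c (β a) : ℂ) else 0}
  add_mem' := by
    rintro Z Z' ⟨c, hc, h⟩ ⟨c', hc', h'⟩
    refine ⟨c + c', by simp [Finset.sum_add_distrib, hc, hc'], fun a b hab => ?_⟩
    have := h a b hab
    have := h' a b hab
    by_cases hab' : a = b <;> simp_all
  zero_mem' := ⟨0, by simp, by simp⟩
  smul_mem' := by
    rintro t Z ⟨c, hc, h⟩
    refine ⟨t • c, by simp [← Finset.mul_sum, hc], fun a b hab => ?_⟩
    have := h a b hab
    by_cases hab' : a = b <;> simp_all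

/-- The linear functional `c ↦ ∑ a, c (β a)`: the trace of the diagonal matrix which is the scalar
`c i` on the block `i`. -/
def blockTrace {n d : ℕ} (β : Fin n → Fin d) : (Fin d → ℝ) →ₗ[ℝ] ℝ where
  toFun c := ∑ a, c (β a)
  map_add' c c' := by simp [Finset.sum_add_distrib]
  map_smul' t c := by simp [Finset.mul_sum]

/-- The coordinates on `stratumModel β`: a real number for each position off the diagonal blocks,
and one for each block, subject to the vanishing of the trace. -/
noncomputable def stratumModelCoord {n d : ℕ} (β : Fin n → Fin d) :
    (({p : Fin n × Fin n // β p.1 ≠ β p.2} → ℝ) × (blockTrace β).ker) →ₗ[ℝ] Herm n :=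
  (hermEquivReal n).toLinearMap ∘ₗ
    { toFun := fun rc => Matrix.of fun a b =>
        if h : β a = β b then (if a = b then rc.2.1 (β a) else 0) else rc.1 ⟨(a, b), h⟩
      map_add' := fun x y => by ext a b; by_cases h : β a = β b <;> by_cases a = b <;> simp_all
      map_smul' := fun t x => by ext a b; by_cases h : β a = β b <;> by_cases a = b <;> simp_all }

theorem range_stratumModelCoord {n d : ℕ} (β : Fin n → Fin d) :
    (stratumModelCoord β).range = stratumModel β := by
  ext Z
  constructor
  · rintro ⟨⟨r, c⟩, rfl⟩
    refine ⟨c.1, c.2, fun a b hab => ?_⟩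
    by_cases h : a = b
    · subst h
      apply Complex.ext <;> simp [stratumModelCoord, hermEquivReal]
    · have h' : ¬ b = a := fun h' => h h'.symm
      apply Complex.ext <;> simp [stratumModelCoord, hermEquivReal, hab, h, h']
  · rintro ⟨c, hc, h⟩
    refine ⟨(fun p => (Z.1 p.1.1 p.1.2).re + (Z.1 p.1.1 p.1.2).im, ⟨c, hc⟩), ?_⟩
    rw [stratumModelCoord, LinearMap.comp_apply, LinearEquiv.coe_coe, ← LinearEquiv.eq_symm_apply]
    ext a b
    by_cases hab : β a = β b
    · have := h a b hab
      by_cases hab' : a = b <;> simp_all [hermEquivReal]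
    · simp [hab, hermEquivReal]

theorem stratumModelCoord_injective {n d : ℕ} {β : Fin n → Fin d} (hβ : Function.Surjective β) :
    Function.Injective (stratumModelCoord β) := by
  refine (hermEquivReal n).injective.comp ?_
  rintro ⟨r, c⟩ ⟨r', c'⟩ h
  have h' := fun a b => congrFun (congrFun h a) b
  refine Prod.ext (funext fun ⟨⟨a, b⟩, hab⟩ => ?_) (Subtype.ext (funext fun i => ?_))
  · simpa [show ¬ β a = β b from hab] using! h' a b
  · obtain ⟨a, rfl⟩ := hβ i
    simpa using! h' a a

theorem finrank_stratumModel {n d : ℕ} {β : Fin n → Fin d} (hβ : Function.Surjective β)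
    (hd : 1 ≤ d) (m : Fin d → ℕ) (hm : ∀ i, Fintype.card {a // β a = i} = m i) :
    Module.finrank ℝ (stratumModel β) + ∑ i, m i ^ 2 + 1 = n ^ 2 + d := by
  classical
  have hker : Module.finrank ℝ (blockTrace β).ker + 1 = d := by
    have : blockTrace β ≠ 0 := fun h => by
      have h1 := LinearMap.congr_fun h (fun _ => 1)
      obtain ⟨a, -⟩ := hβ ⟨0, hd⟩
      have : n ≠ 0 := by rintro rfl; exact a.elim0
      simp [blockTrace, this] at h1
    simpa using! Module.Dual.finrank_ker_add_one_of_ne_zero this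
  have hsame : Fintype.card {p : Fin n × Fin n // β p.1 = β p.2} = ∑ i, m i ^ 2 := by
    have e : {p : Fin n × Fin n // β p.1 = β p.2} ≃ Σ i, {a // β a = i} × {a // β a = i} :=
      { toFun := fun p => ⟨β p.1.1, ⟨p.1.1, rfl⟩, ⟨p.1.2, p.2.symm⟩⟩
        invFun := fun s => ⟨(s.2.1.1, s.2.2.1), s.2.1.2.trans s.2.2.2.symm⟩
        left_inv := fun p => rfl
        right_inv := by rintro ⟨i, ⟨a, rfl⟩, ⟨b, hb⟩⟩; rfl }
    rw [Fintype.card_congr e, Fintype.card_sigma]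
    simp [hm, sq]
  have hcompl := Fintype.card_subtype_compl (fun p : Fin n × Fin n => β p.1 = β p.2)
  have hle := Fintype.card_subtype_le (fun p : Fin n × Fin n => β p.1 = β p.2)
  have hrank : Module.finrank ℝ (stratumModel β) =
      Fintype.card {p : Fin n × Fin n // ¬ β p.1 = β p.2} + Module.finrank ℝ (blockTrace β).ker := by
    rw [← range_stratumModelCoord, LinearMap.finrank_range_of_inj (stratumModelCoord_injective hβ),
      Module.finrank_prod, Module.finrank_fintype_fun_eq_card]
  rw [hsame, Fintype.card_prod, Fintype.card_fin, ← sq] at hcompl hle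
  omega

/-! ### Multiplicity patterns of diagonal and of block diagonal matrices -/

open Polynomial in
theorem roots_charpoly_diagonal_comp {n d : ℕ} {β : Fin n → Fin d} {m : Fin d → ℕ}
    (hm : ∀ i, Fintype.card {a // β a = i} = m i) (l : Fin d → ℂ) :
    (Matrix.diagonal (fun a => l (β a))).charpoly.roots =
      ∑ i, Multiset.replicate (m i) (l i) := by
  classical
  have h0 : ∏ a, (X - C (l (β a))) ≠ 0 := Finset.prod_ne_zero_iff.2 fun a _ => X_sub_C_ne_zero _
  have h1 : (∏ a, (X - C (l (β a)))).roots = ∑ a, {l (β a)} := by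
    rw [roots_prod _ _ h0]
    simp_rw [roots_X_sub_C]
    rfl
  rw [Matrix.charpoly_diagonal, h1, ← Finset.sum_fiberwise _ β]
  refine Finset.sum_congr rfl fun i _ => ?_
  rw [Finset.sum_congr rfl (g := fun _ => {l i})
    (fun a ha => by rw [(Finset.mem_filter.1 ha).2]), Finset.sum_const, Multiset.nsmul_singleton,
    ← hm i, Fintype.card_subtype]

/-- A family of reals with the multiplicity pattern `m` is constant on the blocks of a partition of
its index set into blocks of sizes `m i`. -/
theorem exists_blocks {n d : ℕ} {m : Fin d → ℕ} {v : Fin n → ℝ} {l : Fin d → ℝ}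
    (hl : Function.Injective l) (h : Multiset.map (fun a => (v a : ℂ)) Finset.univ.val =
      ∑ i, Multiset.replicate (m i) (l i : ℂ)) :
    ∃ β : Fin n → Fin d, (∀ a, v a = l (β a)) ∧ ∀ i, Fintype.card {a // β a = i} = m i := by
  classical
  have h1 : ∀ a, ∃ i, v a = l i := fun a => by
    have : (v a : ℂ) ∈ ∑ i, Multiset.replicate (m i) (l i : ℂ) := by
      rw [← h]
      exact Multiset.mem_map_of_mem _ (Finset.mem_univ a)
    obtain ⟨i, -, hi⟩ := Multiset.mem_sum.1 this
    exact ⟨i, by exact_mod_cast Multiset.eq_of_mem_replicate hi⟩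
  choose β hβ using h1
  refine ⟨β, hβ, fun i => ?_⟩
  have h2 := congrArg (Multiset.count (l i : ℂ)) h
  simp only [Multiset.count_map, Multiset.count_sum', Multiset.count_replicate, Complex.ofReal_inj,
    hl.eq_iff, hβ, Finset.sum_ite_eq', Finset.mem_univ, if_true] at h2
  rw [← h2, Fintype.card_subtype]
  simp only [Finset.card_def, Finset.filter_val, eq_comm]

/-- Membership in `densityStratum n m`, as a predicate on all matrices. -/
def HasDensityPattern {n d : ℕ} (m : Fin d → ℕ) (M : Matrix (Fin n) (Fin n) ℂ) : Prop :=
  (M.PosDef ∧ M.trace = 1) ∧ ∃ l : Fin d → ℝ, StrictAnti l ∧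
    M.charpoly.roots = ∑ i, Multiset.replicate (m i) (l i : ℂ)

theorem hasDensityPattern_conj {n d : ℕ} (m : Fin d → ℕ) (M : Matrix (Fin n) (Fin n) ℂ)
    {U : Matrix (Fin n) (Fin n) ℂ} (hU : U * U.conjTranspose = 1) :
    HasDensityPattern m (U * M * U.conjTranspose) ↔ HasDensityPattern m M := by
  have hU' : U.conjTranspose * U = 1 := mul_eq_one_comm.1 hU
  have hunit : IsUnit U := IsUnit.of_mul_eq_one _ hU
  have h1 : (U * M * U.conjTranspose).PosDef ↔ M.PosDef :=
    Matrix.IsUnit.posDef_star_right_conjugate_iff hunit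
  have h2 : (U * M * U.conjTranspose).trace = M.trace := by
    rw [Matrix.trace_mul_comm, ← mul_assoc, hU', one_mul]
  have h3 : (U * M * U.conjTranspose).charpoly = M.charpoly := by
    rw [Matrix.charpoly_mul_comm, ← mul_assoc, hU', one_mul]
  simp only [HasDensityPattern, h1, h2, h3]

/-- An eigenvector `u` of a block diagonal matrix whose diagonal blocks are `ε`-close to the scalars
`l i` can be nonzero on the block `i` only if its eigenvalue is `n ε`-close to `l i`: compare the
entries where `u` is largest on that block. -/
theorem abs_eigenvalue_sub_le {n d : ℕ} {β : Fin n → Fin d} {l : Fin d → ℝ} {ε : ℝ}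
    {Y : Matrix (Fin n) (Fin n) ℂ} (hY : ∀ a b, ‖Y a b‖ ≤ ε)
    (hblock : ∀ a b, β a ≠ β b → Y a b = 0) {u : Fin n → ℂ} {t : ℝ}
    (hu : ∀ b, (l (β b) : ℂ) * u b + ∑ c, Y b c * u c = t * u b) {b : Fin n} (hb : u b ≠ 0) :
    |t - l (β b)| ≤ n * ε := by
  classical
  obtain ⟨a, ha, hmax⟩ := (Finset.univ.filter (fun a => β a = β b)).exists_max_image
    (fun a => ‖u a‖) ⟨b, by simp⟩
  simp only [Finset.mem_filter, Finset.mem_univ, true_and] at ha hmax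
  have hpos : 0 < ‖u a‖ := (norm_pos_iff.2 hb).trans_le (hmax b rfl)
  have h1 : ((t - l (β b) : ℝ) : ℂ) * u a = ∑ c, Y a c * u c := by
    have := hu a
    rw [ha] at this
    push_cast
    linear_combination -this
  have h2 : |t - l (β b)| * ‖u a‖ ≤ n * ε * ‖u a‖ := calc
    |t - l (β b)| * ‖u a‖ = ‖∑ c, Y a c * u c‖ := by
      rw [← h1, norm_mul, Complex.norm_real, Real.norm_eq_abs]
    _ ≤ ∑ c, ‖Y a c * u c‖ := norm_sum_le _ _
    _ ≤ ∑ _c : Fin n, ε * ‖u a‖ := by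
      refine Finset.sum_le_sum fun c _ => ?_
      have hε : 0 ≤ ε := (norm_nonneg _).trans (hY a a)
      by_cases hc : β a = β c
      · rw [norm_mul]
        exact mul_le_mul (hY a c) (hmax c (hc ▸ ha)) (norm_nonneg _) hε
      · rw [hblock a c hc, zero_mul, norm_zero]
        positivity
    _ = n * ε * ‖u a‖ := by simp [mul_assoc]
  exact le_of_mul_le_mul_right h2 hpos

/-- A Hermitian block diagonal matrix with `d` blocks close to distinct scalars, and at most `d`
distinct eigenvalues, is a scalar on each block: each block has an eigenvalue of its own, which leaves
no room for a second one. -/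
theorem eq_diagonal_of_eigenvalues {n d : ℕ} {β : Fin n → Fin d} (hβ : Function.Surjective β)
    {l : Fin d → ℝ} {ε : ℝ} (hsep : ∀ i j, i ≠ j → 2 * (n * ε) < |l i - l j|)
    {Y : Matrix (Fin n) (Fin n) ℂ} (hY : ∀ a b, ‖Y a b‖ ≤ ε)
    (hblock : ∀ a b, β a ≠ β b → Y a b = 0)
    (hM : (Matrix.diagonal (fun a => (l (β a) : ℂ)) + Y).IsHermitian) {l' : Fin d → ℝ}
    {σ : Fin n → Fin d} (hσ : ∀ a, hM.eigenvalues a = l' (σ a)) :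
    ∃ c : Fin d → ℝ, Matrix.diagonal (fun a => (l (β a) : ℂ)) + Y =
      Matrix.diagonal (fun a => (c (β a) : ℂ)) := by
  set M := Matrix.diagonal (fun a => (l (β a) : ℂ)) + Y with hMdef
  set U : Matrix (Fin n) (Fin n) ℂ := hM.eigenvectorUnitary.1 with hU
  have hUU : U * star U = 1 := Unitary.mul_star_self_of_mem hM.eigenvectorUnitary.2
  have hUU' : star U * U = 1 := mul_eq_one_comm.1 hUU
  have hMU : M * U = U * Matrix.diagonal (fun a => (l' (σ a) : ℂ)) := by
    have h := hM.spectral_theorem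
    rw [Unitary.conjStarAlgAut_apply] at h
    have h' : (RCLike.ofReal ∘ hM.eigenvalues : Fin n → ℂ) = fun a => (l' (σ a) : ℂ) :=
      funext fun a => by simp [hσ]
    rw [h'] at h
    conv_lhs => rw [h]
    rw [mul_assoc]
    simp only [← hU, hUU', mul_one]
  have hnear : ∀ a b, U b a ≠ 0 → |l' (σ a) - l (β b)| ≤ n * ε := fun a b hab => by
    refine abs_eigenvalue_sub_le hY hblock (u := fun c => U c a) (fun b => ?_) hab
    have := congrFun (congrFun hMU b) a
    rw [hMdef, Matrix.add_mul, Matrix.add_apply, Matrix.diagonal_mul, Matrix.mul_diagonal,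
      Matrix.mul_apply] at this
    rw [this, mul_comm]
  have hex : ∀ i, ∃ a b, β b = i ∧ U b a ≠ 0 := fun i => by
    obtain ⟨b, rfl⟩ := hβ i
    by_contra! h
    have := congrFun (congrFun hUU b) b
    simp [Matrix.mul_apply, fun a => h a b rfl] at this
  choose f g hg hfg using hex
  have hsf : ∀ i, |l' (σ (f i)) - l i| ≤ n * ε := fun i => by
    simpa [hg i] using hnear (f i) (g i) (hfg i)
  have hclose : ∀ {i j t}, |t - l i| ≤ n * ε → |t - l j| ≤ n * ε → i = j := fun {i j t} h1 h2 => by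
    by_contra hij
    have h3 := hsep i j hij
    have h4 := abs_sub_le (l i) t (l j)
    rw [abs_sub_comm (l i) t] at h4
    linarith
  have hbij : Function.Surjective (fun i => σ (f i)) := Finite.surjective_of_injective
    fun i j hij => hclose (hsf i) (by
      have := hsf j
      rwa [← show σ (f i) = σ (f j) from hij] at this)
  have hc : ∀ a b, U b a ≠ 0 → σ a = σ (f (β b)) := fun a b hab => by
    obtain ⟨i, hi⟩ := hbij (σ a)
    have h1 := hnear a b hab
    rw [← hi] at h1
    rw [← hi, hclose (hsf i) h1]
  refine ⟨fun i => l' (σ (f i)), ?_⟩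
  have h2 : M * U = Matrix.diagonal (fun a => (l' (σ (f (β a))) : ℂ)) * U := by
    rw [hMU]
    ext b a
    rw [Matrix.diagonal_mul, Matrix.mul_diagonal]
    by_cases hab : U b a = 0
    · simp [hab]
    · rw [hc a b hab, mul_comm]
  calc M = M * U * star U := by rw [mul_assoc, hUU, mul_one]
    _ = _ := by rw [h2, mul_assoc, hUU, mul_one]

/-- Near the diagonal matrix with entries `l (β a)`, the block diagonal matrices with multiplicity
pattern `m` are those which are a scalar on each block. -/
theorem hasDensityPattern_diagonal_add_iff {n d : ℕ} {m : Fin d → ℕ} {β : Fin n → Fin d}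
    (hβ : Function.Surjective β) (hm : ∀ i, Fintype.card {a // β a = i} = m i) {l : Fin d → ℝ}
    (hl : StrictAnti l) (hl1 : ∑ a, l (β a) = 1) {ε : ℝ}
    (hsep : ∀ i j, i ≠ j → 2 * (n * ε) < |l i - l j|) (hpos : ∀ i, ε < l i)
    {Y : Matrix (Fin n) (Fin n) ℂ} (hYH : Y.IsHermitian) (hY : ∀ a b, ‖Y a b‖ ≤ ε)
    (hblock : ∀ a b, β a ≠ β b → Y a b = 0) :
    HasDensityPattern m (Matrix.diagonal (fun a => (l (β a) : ℂ)) + Y) ↔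
      ∃ c : Fin d → ℝ, ∑ a, c (β a) = 0 ∧
        ∀ a b, β a = β b → Y a b = if a = b then (c (β a) : ℂ) else 0 := by
  constructor
  · rintro ⟨⟨hpd, htr⟩, l', hl', hroots⟩
    have hM := hpd.1
    rw [hM.roots_charpoly_eq_eigenvalues] at hroots
    obtain ⟨σ, hσ, -⟩ := exists_blocks (v := hM.eigenvalues) hl'.injective hroots
    obtain ⟨c, hc⟩ := eq_diagonal_of_eigenvalues hβ hsep hY hblock hM hσ
    have hYc : Y = Matrix.diagonal (fun a => ((c (β a) - l (β a) : ℝ) : ℂ)) := by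
      rw [eq_sub_of_add_eq' hc, Matrix.diagonal_sub]
      simp
    rw [hc, Matrix.trace_diagonal] at htr
    refine ⟨c - l, ?_, fun a b _ => ?_⟩
    · have : ∑ a, c (β a) = 1 := by exact_mod_cast htr
      simp [this, hl1]
    · rw [hYc, Matrix.diagonal_apply]
      rfl
  · rintro ⟨c, hc0, hc⟩
    have hM : Matrix.diagonal (fun a => (l (β a) : ℂ)) + Y =
        Matrix.diagonal (fun a => (((l + c) (β a) : ℝ) : ℂ)) := by
      ext a b
      by_cases hab : β a = β b
      · rw [Matrix.add_apply, hc a b hab]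
        by_cases hab' : a = b
        · subst hab'
          simp
        · simp [hab']
      · have hab' : a ≠ b := fun h => hab (h ▸ rfl)
        simp [hab', hblock a b hab]
    have hcε : ∀ i, |c i| ≤ ε := fun i => by
      obtain ⟨a, rfl⟩ := hβ i
      have := hY a a
      rwa [hc a a rfl, if_pos rfl, Complex.norm_real, Real.norm_eq_abs] at this
    rw [hM]
    refine ⟨⟨Matrix.PosDef.diagonal fun a => ?_, ?_⟩, l + c, fun i j hij => ?_,
      roots_charpoly_diagonal_comp hm fun i => (((l + c) i : ℝ) : ℂ)⟩
    · have h1 := hpos (β a)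
      have h2 := abs_le.1 (hcε (β a))
      have : 0 < (l + c) (β a) := by
        rw [Pi.add_apply]
        linarith
      exact_mod_cast this
    · rw [Matrix.trace_diagonal, ← Complex.ofReal_sum]
      simp [Finset.sum_add_distrib, hc0, hl1]
    · have h1 := hsep i j hij.ne
      rw [abs_of_pos (sub_pos.2 (hl hij))] at h1
      have h2 := abs_le.1 (hcε i)
      have h3 := abs_le.1 (hcε j)
      have hn : (1 : ℝ) ≤ n := by
        obtain ⟨a, -⟩ := hβ i
        exact_mod_cast Nat.one_le_iff_ne_zero.2 (by rintro rfl; exact a.elim0)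
      have h4 : ε ≤ n * ε := le_mul_of_one_le_left ((abs_nonneg _).trans (hcε i)) hn
      simp only [Pi.add_apply]
      linarith

/-! ### Analytic and differentiable matrix-valued maps -/

section MatrixCalculus

variable {E : Type*} [NormedAddCommGroup E] [NormedSpace ℝ E] {n : ℕ}
  {f g : E → Matrix (Fin n) (Fin n) ℂ} {x : E}

theorem analyticAt_matrix_iff :
    AnalyticAt ℝ f x ↔ ∀ a b, AnalyticAt ℝ (fun z => f z a b) x :=
  (analyticAt_pi_iff (f := fun (a : Fin n) z => (f z a : Fin n → ℂ))).trans
    (forall_congr' fun a => analyticAt_pi_iff (f := fun (b : Fin n) z => f z a b))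

theorem AnalyticAt.matrix_mul (hf : AnalyticAt ℝ f x) (hg : AnalyticAt ℝ g x) :
    AnalyticAt ℝ (fun z => f z * g z) x := by
  rw [analyticAt_matrix_iff] at *
  intro a b
  simp only [Matrix.mul_apply]
  exact Finset.analyticAt_fun_sum _ fun c _ => (hf a c).mul (hg c b)

theorem AnalyticAt.matrix_conjTranspose (hf : AnalyticAt ℝ f x) :
    AnalyticAt ℝ (fun z => (f z).conjTranspose) x := by
  rw [analyticAt_matrix_iff] at *
  intro a b
  exact (Complex.conjCLE.analyticAt _).comp (hf b a)

theorem AnalyticAt.matrix_det (hf : AnalyticAt ℝ f x) : AnalyticAt ℝ (fun z => (f z).det) x := by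
  rw [analyticAt_matrix_iff] at hf
  simp only [Matrix.det_apply']
  exact Finset.analyticAt_fun_sum _ fun s _ =>
    analyticAt_const.mul (Finset.analyticAt_fun_prod _ fun i _ => hf _ _)

theorem AnalyticAt.matrix_inv (hf : AnalyticAt ℝ f x) (h0 : IsUnit (f x)) :
    AnalyticAt ℝ (fun z => (f z)⁻¹) x := by
  have hdet : (f x).det ≠ 0 := ((Matrix.isUnit_iff_isUnit_det _).1 h0).ne_zero
  rw [analyticAt_matrix_iff]
  intro a b
  simp only [Matrix.inv_def, Matrix.smul_apply, Ring.inverse_eq_inv', Matrix.adjugate_apply,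
    smul_eq_mul]
  refine (hf.matrix_det.inv hdet).mul (AnalyticAt.matrix_det (analyticAt_matrix_iff.2 fun i j => ?_))
  by_cases hi : i = b
  · subst hi
    simpa using analyticAt_const
  · simpa [Matrix.updateRow_ne hi] using analyticAt_matrix_iff.1 hf i j

theorem hasDerivAt_matrix_iff {f : ℝ → Matrix (Fin n) (Fin n) ℂ} {f' : Matrix (Fin n) (Fin n) ℂ}
    {t : ℝ} : HasDerivAt f f' t ↔ ∀ a b, HasDerivAt (fun s => f s a b) (f' a b) t :=
  (hasDerivAt_pi (φ := fun s => (f s : Fin n → Fin n → ℂ))).trans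
    (forall_congr' fun a => hasDerivAt_pi (φ := fun s => f s a))

theorem HasDerivAt.matrix_mul {f g : ℝ → Matrix (Fin n) (Fin n) ℂ}
    {f' g' : Matrix (Fin n) (Fin n) ℂ} {t : ℝ} (hf : HasDerivAt f f' t) (hg : HasDerivAt g g' t) :
    HasDerivAt (fun s => f s * g s) (f' * g t + f t * g') t := by
  rw [hasDerivAt_matrix_iff] at *
  intro a b
  simp only [Matrix.mul_apply, Matrix.add_apply, ← Finset.sum_add_distrib]
  exact HasDerivAt.fun_sum fun c _ => (hf a c).mul (hg c b)

theorem HasDerivAt.matrix_conjTranspose {f : ℝ → Matrix (Fin n) (Fin n) ℂ}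
    {f' : Matrix (Fin n) (Fin n) ℂ} {t : ℝ} (hf : HasDerivAt f f' t) :
    HasDerivAt (fun s => (f s).conjTranspose) f'.conjTranspose t := by
  rw [hasDerivAt_matrix_iff] at *
  exact fun a b => (hf b a).star

end MatrixCalculus

/-! ### The Cayley transform -/

/-- The Cayley transform `(1 + X) (1 - X)⁻¹`, which sends skew-Hermitian matrices to unitary ones. -/
noncomputable def cayley {n : ℕ} (X : Matrix (Fin n) (Fin n) ℂ) : Matrix (Fin n) (Fin n) ℂ :=
  (1 + X) * (1 - X)⁻¹

theorem isUnit_one_sub_of_skew {n : ℕ} {X : Matrix (Fin n) (Fin n) ℂ}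
    (hX : X.conjTranspose = -X) : IsUnit (1 - X) := by
  have h1 : (1 + X) * (1 - X) = 1 + X.conjTranspose * X := by rw [hX]; noncomm_ring
  have h2 : IsUnit ((1 + X) * (1 - X)) := by
    rw [h1]
    exact (Matrix.PosDef.one.add_posSemidef (Matrix.posSemidef_conjTranspose_mul_self X)).isUnit
  rw [Matrix.isUnit_iff_isUnit_det, Matrix.det_mul] at h2
  exact (Matrix.isUnit_iff_isUnit_det _).2 (isUnit_of_mul_isUnit_right h2)

theorem cayley_mul_conjTranspose {n : ℕ} {X : Matrix (Fin n) (Fin n) ℂ}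
    (hX : X.conjTranspose = -X) : cayley X * (cayley X).conjTranspose = 1 := by
  have h1 := isUnit_one_sub_of_skew hX
  have h2 : IsUnit (1 + X) := by
    simpa using isUnit_one_sub_of_skew (X := -X) (by simp [hX])
  rw [Matrix.isUnit_iff_isUnit_det] at h1 h2
  have hcomm : (1 - X)⁻¹ * (1 + X)⁻¹ = (1 + X)⁻¹ * (1 - X)⁻¹ := by
    rw [← Matrix.mul_inv_rev, ← Matrix.mul_inv_rev]
    congr 1
    noncomm_ring
  have h3 : (cayley X).conjTranspose = (1 + X)⁻¹ * (1 - X) := by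
    simp [cayley, Matrix.conjTranspose_mul, Matrix.conjTranspose_nonsing_inv, hX, sub_eq_add_neg]
  calc cayley X * (cayley X).conjTranspose
      = (1 + X) * ((1 - X)⁻¹ * (1 + X)⁻¹) * (1 - X) := by rw [h3, cayley]; simp only [mul_assoc]
    _ = ((1 + X) * (1 + X)⁻¹) * ((1 - X)⁻¹ * (1 - X)) := by rw [hcomm]; simp only [mul_assoc]
    _ = 1 := by rw [Matrix.mul_nonsing_inv _ h2, Matrix.nonsing_inv_mul _ h1, one_mul]

theorem cayley_zero {n : ℕ} : cayley (0 : Matrix (Fin n) (Fin n) ℂ) = 1 := by simp [cayley]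

theorem AnalyticAt.cayley {E : Type*} [NormedAddCommGroup E] [NormedSpace ℝ E] {n : ℕ}
    {f : E → Matrix (Fin n) (Fin n) ℂ} {x : E} (hf : AnalyticAt ℝ f x) (h0 : f x = 0) :
    AnalyticAt ℝ (fun z => cayley (f z)) x :=
  (analyticAt_const.add hf).matrix_mul
    ((analyticAt_const.sub hf).matrix_inv (by simp [h0]))

theorem hasDerivAt_cayley {n : ℕ} (X : Matrix (Fin n) (Fin n) ℂ) :
    HasDerivAt (fun t : ℝ => cayley (t • X)) ((2 : ℝ) • X) 0 := by
  have hlin : HasDerivAt (fun t : ℝ => t • X) X 0 := by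
    simpa using! (hasDerivAt_id (0 : ℝ)).smul_const X
  have han : AnalyticAt ℝ (fun t : ℝ => t • X) 0 := analyticAt_id.smul analyticAt_const
  have h := (han.cayley (zero_smul ℝ X)).differentiableAt.hasDerivAt
  have hev : (fun t : ℝ => cayley (t • X) * (1 - t • X)) =ᶠ[nhds 0] fun t => 1 + t • X := by
    have hcont : ContinuousAt (fun t : ℝ => (1 - t • X).det) 0 :=
      (analyticAt_const.sub han).matrix_det.continuousAt
    filter_upwards [hcont.eventually_ne (y := 0) (by simp)] with t ht
    rw [cayley, mul_assoc, Matrix.nonsing_inv_mul _ (isUnit_iff_ne_zero.2 ht), mul_one]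
  -- Differentiating `cayley (t X) (1 - t X) = 1 + t X` determines the derivative.
  have h1 := (h.matrix_mul (hlin.const_sub 1)).unique
    ((hlin.const_add 1).congr_of_eventuallyEq hev)
  simp only [zero_smul, sub_zero, mul_one, cayley_zero, mul_neg, one_mul] at h1
  have h2 : ∀ A : Matrix (Fin n) (Fin n) ℂ, A + -X = X → A = (2 : ℝ) • X := fun A hA => by
    rw [two_smul, ← sub_eq_iff_eq_add, sub_eq_add_neg]
    exact hA
  exact h2 _ h1 ▸ h

/-! ### The straightening map -/

section Straightening

variable {n d : ℕ} (β : Fin n → Fin d) (l : Fin d → ℝ)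

/-- The block diagonal part of a matrix. -/
def blockPart : Matrix (Fin n) (Fin n) ℂ →ₗ[ℝ] Matrix (Fin n) (Fin n) ℂ where
  toFun Z := Matrix.of fun a b => if β a = β b then Z a b else 0
  map_add' Z Z' := by ext a b; by_cases h : β a = β b <;> simp [h]
  map_smul' t Z := by ext a b; by_cases h : β a = β b <;> simp [h]

/-- For `D` diagonal with entries `l (β a)`, where `l` is injective, the solution `X`, with zero diagonal blocks,
of `2 (X D - D X) = Z - blockPart β Z`. On the diagonal blocks the denominator vanishes, and so, by
the convention on division by zero, does the quotient. -/
noncomputable def offBlockPart : Matrix (Fin n) (Fin n) ℂ →ₗ[ℝ] Matrix (Fin n) (Fin n) ℂ where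
  toFun Z := Matrix.of fun a b => Z a b / (2 * (l (β b) - l (β a)) : ℝ)
  map_add' Z Z' := by ext a b; simp [add_div]
  map_smul' t Z := by ext a b; simp [mul_div_assoc]

variable {β l}

theorem isHermitian_blockPart {Z : Matrix (Fin n) (Fin n) ℂ} (hZ : Z.IsHermitian) :
    (blockPart β Z).IsHermitian := by
  ext a b
  by_cases h : β a = β b
  · simpa [blockPart, h] using hZ.apply a b
  · simp [blockPart, h, Ne.symm h]

theorem offBlockPart_conjTranspose {Z : Matrix (Fin n) (Fin n) ℂ} (hZ : Z.IsHermitian) :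
    (offBlockPart β l Z).conjTranspose = -offBlockPart β l Z := by
  ext a b
  have h : star (Z b a) = Z a b := hZ.apply a b
  change star (Z b a / ((2 * (l (β a) - l (β b)) : ℝ) : ℂ)) =
    -(Z a b / ((2 * (l (β b) - l (β a)) : ℝ) : ℂ))
  rw [star_div₀, h, Complex.star_def, Complex.conj_ofReal, ← div_neg, ← Complex.ofReal_neg]
  congr 2
  ring

theorem commutator_offBlockPart_add_blockPart (hl : Function.Injective l)
    (Z : Matrix (Fin n) (Fin n) ℂ) :
    (2 : ℝ) • offBlockPart β l Z * Matrix.diagonal (fun a => (l (β a) : ℂ)) + blockPart β Z -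
      Matrix.diagonal (fun a => (l (β a) : ℂ)) * ((2 : ℝ) • offBlockPart β l Z) = Z := by
  ext a b
  rw [Matrix.sub_apply, Matrix.add_apply, Matrix.mul_diagonal, Matrix.diagonal_mul]
  by_cases h : β a = β b
  · simp [offBlockPart, blockPart, h]
  · have h1 : (l (β b) : ℂ) - l (β a) ≠ 0 :=
      sub_ne_zero.2 fun h' => h (hl (by exact_mod_cast h'.symm))
    simp [offBlockPart, blockPart, h]
    field_simp

variable (β l)

/-- The matrices `W (D + Y) Wᴴ`, where `D` is diagonal with entries `l (β a)`, `Y` is the block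
diagonal part of `Z`, and `W` is `V` times the Cayley transform of `offBlockPart β l Z`. -/
noncomputable def straightening (V Z : Matrix (Fin n) (Fin n) ℂ) : Matrix (Fin n) (Fin n) ℂ :=
  V * cayley (offBlockPart β l Z) *
    (Matrix.diagonal (fun a => (l (β a) : ℂ)) + blockPart β Z) *
    (V * cayley (offBlockPart β l Z)).conjTranspose

variable {β l} {V : Matrix (Fin n) (Fin n) ℂ}

theorem isHermitian_straightening {Z : Matrix (Fin n) (Fin n) ℂ} (hZ : Z.IsHermitian) :
    (straightening β l V Z).IsHermitian :=
  Matrix.isHermitian_mul_mul_conjTranspose _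
    ((Matrix.isHermitian_diagonal_of_self_adjoint _ (by ext a; simp)).add
      (isHermitian_blockPart hZ))

theorem straightening_zero :
    straightening β l V 0 =
      V * Matrix.diagonal (fun a => (l (β a) : ℂ)) * V.conjTranspose := by
  simp [straightening, cayley_zero]

theorem analyticAt_straightening : AnalyticAt ℝ (fun Z : Herm n => straightening β l V Z) 0 := by
  have hlin : ∀ T : Matrix (Fin n) (Fin n) ℂ →ₗ[ℝ] Matrix (Fin n) (Fin n) ℂ,
      AnalyticAt ℝ (fun Z : Herm n => T Z) 0 := fun T =>
    (LinearMap.toContinuousLinearMap (T ∘ₗ (Herm n).subtype)).analyticAt 0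
  have hW : AnalyticAt ℝ (fun Z : Herm n => V * cayley (offBlockPart β l Z)) 0 :=
    analyticAt_const.matrix_mul ((hlin _).cayley (by simp))
  exact (hW.matrix_mul (analyticAt_const.add (hlin _))).matrix_mul hW.matrix_conjTranspose

theorem hasDerivAt_straightening (hl : Function.Injective l) {Z : Matrix (Fin n) (Fin n) ℂ}
    (hZ : Z.IsHermitian) :
    HasDerivAt (fun t : ℝ => straightening β l V (t • Z)) (V * Z * V.conjTranspose) 0 := by
  set D : Matrix (Fin n) (Fin n) ℂ := Matrix.diagonal (fun a => (l (β a) : ℂ)) with hD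
  set X := offBlockPart β l Z with hX
  have hW : HasDerivAt (fun t : ℝ => V * cayley (t • X)) (V * ((2 : ℝ) • X)) 0 := by
    simpa using! (hasDerivAt_const (0 : ℝ) V).matrix_mul (hasDerivAt_cayley X)
  have hY : HasDerivAt (fun t : ℝ => D + t • blockPart β Z) (blockPart β Z) 0 := by
    have : HasDerivAt (fun t : ℝ => t • blockPart β Z) (blockPart β Z) 0 := by
      simpa using! (hasDerivAt_id (0 : ℝ)).smul_const (blockPart β Z)
    exact this.const_add D
  have h := (hW.matrix_mul hY).matrix_mul hW.matrix_conjTranspose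
  have hXs : X.conjTranspose = -X := offBlockPart_conjTranspose hZ
  have hfun : (fun t : ℝ => straightening β l V (t • Z)) = fun t : ℝ => V * cayley (t • X) *
      (D + t • blockPart β Z) * (V * cayley (t • X)).conjTranspose := by
    funext t
    simp only [straightening, map_smul, hX, hD]
  rw [hfun]
  convert h using 1
  simp only [zero_smul, add_zero, cayley_zero, mul_one, Matrix.conjTranspose_mul,
    Matrix.conjTranspose_smul, hXs, star_trivial]
  conv_lhs => rw [← commutator_offBlockPart_add_blockPart (β := β) hl Z, ← hX, ← hD]
  rw [smul_neg]
  noncomm_ring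

theorem hasDensityPattern_straightening (hV : V * V.conjTranspose = 1) (m : Fin d → ℕ)
    {Z : Matrix (Fin n) (Fin n) ℂ} (hZ : Z.IsHermitian) :
    HasDensityPattern m (straightening β l V Z) ↔
      HasDensityPattern m (Matrix.diagonal (fun a => (l (β a) : ℂ)) + blockPart β Z) := by
  refine hasDensityPattern_conj m _ ?_
  rw [Matrix.conjTranspose_mul, mul_assoc, ← mul_assoc (cayley _),
    cayley_mul_conjTranspose (offBlockPart_conjTranspose hZ), one_mul, hV]

/-- Conjugation by a unitary matrix, as a linear automorphism of the Hermitian matrices. -/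
noncomputable def hermConj (hV : V * V.conjTranspose = 1) : Herm n ≃L[ℝ] Herm n :=
  LinearEquiv.toContinuousLinearEquiv
    { toFun := fun Z => ⟨V * Z.1 * V.conjTranspose, Matrix.isHermitian_mul_mul_conjTranspose V Z.2⟩
      map_add' := fun Z Z' => Subtype.ext <| by simp [mul_add, add_mul]
      map_smul' := fun t Z => Subtype.ext <| by simp
      invFun := fun Z => ⟨V.conjTranspose * Z.1 * V, Matrix.isHermitian_conjTranspose_mul_mul V Z.2⟩
      left_inv := fun Z => Subtype.ext <| by
        have hV' : V.conjTranspose * V = 1 := mul_eq_one_comm.1 hV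
        calc V.conjTranspose * (V * Z.1 * V.conjTranspose) * V
            = (V.conjTranspose * V) * Z.1 * (V.conjTranspose * V) := by simp only [mul_assoc]
          _ = Z.1 := by rw [hV', one_mul, mul_one]
      right_inv := fun Z => Subtype.ext <| by
        calc V * (V.conjTranspose * Z.1 * V) * V.conjTranspose
            = (V * V.conjTranspose) * Z.1 * (V * V.conjTranspose) := by simp only [mul_assoc]
          _ = Z.1 := by rw [hV, one_mul, mul_one] }

end Straightening

/-- Around a diagonalized point of the stratum, `straightening` is a local diffeomorphism that carries
`stratumModel β` to the stratum. -/
theorem exists_sliceChart_densityStratum {n d : ℕ} {m : Fin d → ℕ} {β : Fin n → Fin d}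
    (hβ : Function.Surjective β) (hm : ∀ i, Fintype.card {a // β a = i} = m i) {l : Fin d → ℝ}
    (hl : StrictAnti l) (hl1 : ∑ a, l (β a) = 1) (hpos : ∀ i, 0 < l i)
    {V : Matrix (Fin n) (Fin n) ℂ} (hV : V * V.conjTranspose = 1) {p : Herm n}
    (hp : p.1 = V * Matrix.diagonal (fun a => (l (β a) : ℂ)) * V.conjTranspose) {q k : ℕ}
    (hq : Module.finrank ℝ (stratumModel β) = q) (hqk : q + k = Module.finrank ℝ (Herm n)) :
    ∃ φ : OpenPartialHomeomorph (Herm n) ((Fin q → ℝ) × (Fin k → ℝ)),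
      p ∈ φ.source ∧ IsAnalyticSliceChart (densityStratum n m) φ := by
  obtain ⟨r, hr⟩ := (Herm n).subtype.exists_leftInverse_of_injective (Submodule.ker_subtype _)
  -- Composing with a linear retraction makes analyticity into the subtype immediate.
  let Ψ : Herm n → Herm n := fun Z => r (straightening β l V Z)
  have hΨ : ∀ Z : Herm n, (Ψ Z).1 = straightening β l V Z := fun Z =>
    congrArg Subtype.val (LinearMap.congr_fun hr ⟨_, isHermitian_straightening Z.2⟩)
  have han : AnalyticAt ℝ Ψ 0 :=
    ((LinearMap.toContinuousLinearMap r).analyticAt _).comp analyticAt_straightening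
  have hΨ0 : Ψ 0 = p := Subtype.ext <| by rw [hΨ, hp]; exact straightening_zero
  have hderiv : HasFDerivAt Ψ (hermConj hV : Herm n →L[ℝ] Herm n) 0 := by
    have h := han.differentiableAt.hasFDerivAt
    suffices heq : (hermConj hV : Herm n →L[ℝ] Herm n) = fderiv ℝ Ψ 0 by
      rw [heq]
      exact h
    ext1 Z
    apply Subtype.ext
    have hpath : HasDerivAt (fun t : ℝ => t • Z) Z 0 := by
      simpa using! (hasDerivAt_id (0 : ℝ)).smul_const Z
    have h1 : HasDerivAt (fun t : ℝ => Ψ (t • Z)) (fderiv ℝ Ψ 0 Z) 0 := by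
      rw [← zero_smul ℝ Z] at h
      simpa using! h.comp_hasDerivAt (0 : ℝ) hpath
    have h2 : HasDerivAt (fun t : ℝ => (Ψ (t • Z)).1) (fderiv ℝ Ψ 0 Z).1 0 :=
      (Herm n).subtypeL.hasFDerivAt.comp_hasDerivAt (0 : ℝ) h1
    simp only [hΨ] at h2
    exact (hasDerivAt_straightening hl.injective Z.2).unique h2
  obtain ⟨ε, hε, hsep, hεl⟩ : ∃ ε : ℝ, 0 < ε ∧ (∀ i j, i ≠ j → 2 * (n * ε) < |l i - l j|) ∧
      ∀ i, ε < l i := by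
    have h1 : ∀ᶠ ε : ℝ in nhdsWithin 0 (Set.Ioi 0), ∀ i j, i ≠ j → 2 * (n * ε) < |l i - l j| := by
      refine Filter.eventually_all.2 fun i => Filter.eventually_all.2 fun j => ?_
      by_cases hij : i = j
      · simp [hij]
      · have hc : Filter.Tendsto (fun ε : ℝ => 2 * (n * ε)) (nhds 0) (nhds 0) :=
          Continuous.tendsto' (by fun_prop) _ _ (by simp)
        have hlt : 0 < |l i - l j| := abs_pos.2 (sub_ne_zero.2 fun h => hij (hl.injective h))
        exact (hc.mono_left nhdsWithin_le_nhds).eventually_lt_const hlt |>.mono fun _ h _ => h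
    have h2 : ∀ᶠ ε : ℝ in nhdsWithin 0 (Set.Ioi 0), ∀ i, ε < l i :=
      Filter.eventually_all.2 fun i => nhdsWithin_le_nhds (eventually_lt_nhds (hpos i))
    exact (eventually_mem_nhdsWithin.and (h1.and h2)).exists
  rw [← hΨ0]
  refine exists_isAnalyticSliceChart han (hermConj hV) hderiv (stratumModel β) hq hqk ?_
  filter_upwards [Metric.closedBall_mem_nhds (0 : Herm n) hε] with Z hZ
  have hZε : ∀ a b, ‖Z.1 a b‖ ≤ ε := fun a b =>
    (Matrix.norm_entry_le_entrywise_sup_norm Z.1).trans (by simpa using hZ)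
  have hiff := (hasDensityPattern_straightening (β := β) (l := l) hV m Z.2).trans
    (hasDensityPattern_diagonal_add_iff hβ hm hl hl1 hsep hεl (isHermitian_blockPart Z.2)
    (fun a b => ?_) fun a b hab => by simp [blockPart, hab])
  · rw [← hΨ] at hiff
    refine hiff.trans (exists_congr fun c => and_congr_right fun _ => forall_congr' fun a =>
      forall_congr' fun b => imp_congr_right fun hab => ?_)
    simp [blockPart, hab]
  · by_cases hab : β a = β b
    · simpa [blockPart, hab] using hZε a b
    · simpa [blockPart, hab] using hε.le

theorem lemma1 (n d : ℕ) (hd : 1 ≤ d) (m : Fin d → ℕ) (hm : ∀ i, 1 ≤ m i)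
    (hsum : ∑ i, m i = n) :
    ∃ k : ℕ, (k : ℤ) = ∑ i, (m i : ℤ) ^ 2 - (d : ℤ) + 1 ∧
      IsAnalyticSubmanifold (densityStratum n m) k := by
  have hdle : d ≤ ∑ i, m i ^ 2 := by
    calc d = ∑ _i : Fin d, 1 := by simp
      _ ≤ ∑ i, m i ^ 2 := Finset.sum_le_sum fun i _ => Nat.one_le_pow _ _ (hm i)
  -- The dimension count for one surjection `β` with fibres of sizes `m i` gives `codim ≤ n ^ 2`.
  have hfib : ∀ β : Fin n → Fin d, (∀ i, Fintype.card {a // β a = i} = m i) →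
      Function.Surjective β := fun β h i => by
    obtain ⟨a⟩ := Fintype.card_pos_iff.1 ((hm i).trans_eq (h i).symm)
    exact ⟨a.1, a.2⟩
  obtain ⟨e⟩ : Nonempty ((Σ i, Fin (m i)) ≃ Fin n) :=
    ⟨Fintype.equivFinOfCardEq (by simp [hsum])⟩
  have hβ₀ : ∀ i, Fintype.card {a // (e.symm a).1 = i} = m i := fun i => by
    rw [Fintype.card_congr ((e.symm.subtypeEquiv (q := fun s => s.1 = i) fun a => Iff.rfl).trans
      (Equiv.sigmaSubtype i)), Fintype.card_fin]
  have hle := finrank_stratumModel (hfib _ hβ₀) hd m hβ₀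
  refine ⟨∑ i, m i ^ 2 + 1 - d, ?_, n ^ 2 - (∑ i, m i ^ 2 + 1 - d), ?_, ?_⟩
  · rw [Nat.cast_sub (by omega)]
    push_cast
    ring
  · rw [finrank_herm]
    omega
  · rintro p ⟨⟨hpd, htr⟩, l, hl, hroots⟩
    have hM := hpd.1
    rw [hM.roots_charpoly_eq_eigenvalues] at hroots
    obtain ⟨β, hβ, hcard⟩ := exists_blocks (v := hM.eigenvalues) hl.injective hroots
    have hsurj := hfib β hcard
    have hdim := finrank_stratumModel hsurj hd m hcard
    have htr' := hM.trace_eq_sum_eigenvalues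
    rw [htr] at htr'
    refine exists_sliceChart_densityStratum hsurj hcard hl ?_ (fun i => ?_)
      (V := hM.eigenvectorUnitary.1) (Unitary.mul_star_self_of_mem hM.eigenvectorUnitary.2)
      ?_ (by omega) (by rw [finrank_herm]; omega)
    · have : (1 : ℂ) = ((∑ a, l (β a) : ℝ) : ℂ) := by simpa [hβ] using htr'
      exact_mod_cast this.symm
    · obtain ⟨a, rfl⟩ := hsurj i
      rw [← hβ]
      exact hpd.eigenvalues_pos a
    · have h := hM.spectral_theorem
      rw [Unitary.conjStarAlgAut_apply] at h
      have h' : (RCLike.ofReal ∘ hM.eigenvalues : Fin n → ℂ) = fun a => (l (β a) : ℂ) :=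
        funext fun a => by simp [hβ]
      rwa [h'] at h
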